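/- **Theorem.** Let $S$ be a real $m\times n$ matrix (the signature matrix), let $\Sigma$ be a positive semidefinite $m\times m$ matrix, and let $\mu\in\mathbb{R}^m$. Let $\bar{\bar S}$ be the $\frac{m(m+1)}{2}\times n$ matrix whose rows are the entrywise products of pairs of rows of $S$, one row for each unordered pair of row indices with repetition allowed. For a real diagonal matrix $P=\mathrm{diag}(p_1,\dots,p_n)$ put $M_P=SPS^T+\Sigma$; call $P$ admissible if $M_P$ is positive definite. For $Y_1,\dots,Y_L\in\mathbb{R}^m$ consider the maximum likelihood (ML) power-estimation problem of minimizing over $P$ $$\Phi_L(P)=\frac1L\sum_{i=1}^{L}(Y_i-\mu)^T M_P^{-1}(Y_i-\mu)+\ln|\det M_P| .$$ (a) For every $L$ and all $Y_1,\dots,Y_L\in\mathbb{R}^m$: if the minimization of $\Phi_L$ over all admissible $P$ has a unique solution, then $\mathrm{rank}(\bar{\bar S})=n$. Now let $Y_i=SP_0^{1/2}X_i+N_i$ for $i=1,2,\dots$, where $P_0=\mathrm{diag}(p^0_1,\dots,p^0_n)$ is an admissible matrix with $p^0_j\ge 0$ for all $j$ (the true powers), $X_i\sim\mathcal N(0,I_n)$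 and $N_i\sim\mathcal N(\mu,\Sigma)$ are independent for each $i$, and the pairs $(X_i,N_i)$, $i\ge 1$, are mutually independent. (b) If $\mathrm{rank}(\bar{\bar S})=n$, then almost surely, for all sufficiently large $L$, the minimization of $\Phi_L$ over all admissible $P$ has a unique solution, and so has the minimization of $\Phi_L$ over all admissible $P$ with nonnegative entries. (c) If moreover $p^0_j>0$ for all $j$, then the analogue of (a) holds for nonnegative powers: almost surely, for all sufficiently large $L$, if the minimization of $\Phi_L$ over all admissible $P$ with nonnegative entries has a unique solution, then $\mathrm{rank}(\bar{\bar S})=n$. -/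

import Mathlib

open MeasureTheory ProbabilityTheory Filter
open scoped Matrix

/-- Index set of the rows of the pair-product matrix: unordered pairs of chip indices, repetition
allowed, each represented by its ordered representative. -/
abbrev PairIndex (m : ℕ) : Type := {q : Fin m × Fin m // q.1 ≤ q.2}

/-- The matrix whose rows are the entrywise products of pairs of rows of `S` (a row may be
paired with itself). -/
def pairProducts {m n : ℕ} (S : Matrix (Fin m) (Fin n) ℝ) : Matrix (PairIndex m) (Fin n) ℝ :=
  Matrix.of fun q j => S q.1.1 j * S q.1.2 j

/-- The matrix `M_P = S P Sᵀ + C`, where `P = diag p` and `C` is the noise covariance. -/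
def covOf {m n : ℕ} (S : Matrix (Fin m) (Fin n) ℝ) (C : Matrix (Fin m) (Fin m) ℝ)
    (p : Fin n → ℝ) : Matrix (Fin m) (Fin m) ℝ :=
  S * Matrix.diagonal p * Sᵀ + C

/-- The received vector `S P^(1/2) x + w` for the user data `x` and the noise `w`. -/
noncomputable def received {m n : ℕ} (S : Matrix (Fin m) (Fin n) ℝ) (p : Fin n → ℝ)
    (x : EuclideanSpace ℝ (Fin n)) (w : EuclideanSpace ℝ (Fin m)) : EuclideanSpace ℝ (Fin m) :=
  WithLp.toLp 2 ((S * Matrix.diagonal fun j => Real.sqrt (p j)) *ᵥ x.ofLp) + w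

/-- The objective of the ML power estimation from the observations `y 0, …, y (L - 1)`. -/
noncomputable def mlObjective {m n : ℕ} (S : Matrix (Fin m) (Fin n) ℝ)
    (C : Matrix (Fin m) (Fin m) ℝ) (μ : EuclideanSpace ℝ (Fin m)) (L : ℕ)
    (y : ℕ → EuclideanSpace ℝ (Fin m)) (p : Fin n → ℝ) : ℝ :=
  (1 / (L : ℝ)) *
      ∑ i ∈ Finset.range L, (y i - μ).ofLp ⬝ᵥ ((covOf S C p)⁻¹ *ᵥ (y i - μ).ofLp)
    + Real.log |(covOf S C p).det|

/-- The diagonal matrices `P` for which `M_P` is the covariance matrix of a nondegenerate Gaussian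
distribution, so that the likelihood is defined. -/
def admissible {m n : ℕ} (S : Matrix (Fin m) (Fin n) ℝ) (C : Matrix (Fin m) (Fin m) ℝ) :
    Set (Fin n → ℝ) :=
  {p | (covOf S C p).PosDef}

/-- The admissible diagonal matrices with nonnegative entries. -/
def admissibleNonneg {m n : ℕ} (S : Matrix (Fin m) (Fin n) ℝ) (C : Matrix (Fin m) (Fin m) ℝ) :
    Set (Fin n → ℝ) :=
  {p | (∀ j, 0 ≤ p j) ∧ p ∈ admissible S C}

/-- The ML minimization over the feasible set `D` has exactly one solution. -/
def HasUniqueMLSolution {m n : ℕ} (D : Set (Fin n → ℝ)) (S : Matrix (Fin m) (Fin n) ℝ)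
    (C : Matrix (Fin m) (Fin m) ℝ) (μ : EuclideanSpace ℝ (Fin m)) (L : ℕ)
    (y : ℕ → EuclideanSpace ℝ (Fin m)) : Prop :=
  ∃! p : Fin n → ℝ, p ∈ D ∧ ∀ q ∈ D, mlObjective S C μ L y p ≤ mlObjective S C μ L y q

section MatrixLoss

variable {ι : Type*} [Fintype ι] [DecidableEq ι]

/-- Twice the negative log-likelihood, up to constants, of the covariance `M` of a centred
Gaussian sample with second moment matrix `A`. -/
noncomputable def gaussLoss (A M : Matrix ι ι ℝ) : ℝ :=
  (A * M⁻¹).trace + Real.log |M.det|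

lemma Matrix.PosDef.exists_simultaneous_diagonal {A D : Matrix ι ι ℝ} (hA : A.PosDef)
    (hD : D.IsHermitian) : ∃ (W : Matrix ι ι ℝ) (d : ι → ℝ),
      IsUnit W ∧ A = W * Wᵀ ∧ D = W * Matrix.diagonal d * Wᵀ := by
  obtain ⟨B, hBu, hB⟩ : ∃ B : Matrix ι ι ℝ, IsUnit B ∧ A = B * Bᵀ := by
    open scoped MatrixOrder in
    have h0 := CFC.sqrt_mul_sqrt_self A hA.posSemidef.nonneg
    have hs : (CFC.sqrt A)ᵀ = CFC.sqrt A :=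
      (CFC.sqrt_nonneg A).isSelfAdjoint.star_eq
    refine ⟨CFC.sqrt A, ?_, by rw [hs, h0]⟩
    have := hA.isUnit
    rw [← h0] at this
    exact isUnit_of_mul_isUnit_left this
  have hBi : B * B⁻¹ = 1 := Matrix.mul_nonsing_inv _ ((Matrix.isUnit_iff_isUnit_det _).1 hBu)
  have hE : (B⁻¹ * D * (B⁻¹)ᵀ).IsHermitian := by
    have := Matrix.isHermitian_mul_mul_conjTranspose B⁻¹ hD
    simpa [Matrix.conjTranspose_eq_transpose_of_trivial] using this
  have hU := hE.eigenvectorUnitary.2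
  set U : Matrix ι ι ℝ := (hE.eigenvectorUnitary : Matrix ι ι ℝ) with hUd
  have hU' : U * Uᵀ = 1 := by
    have := (Unitary.mem_iff.1 hU).2
    simpa [Matrix.star_eq_conjTranspose, Matrix.conjTranspose_eq_transpose_of_trivial] using this
  have hsp : B⁻¹ * D * (B⁻¹)ᵀ = U * Matrix.diagonal hE.eigenvalues * Uᵀ := by
    have := hE.spectral_theorem
    simpa [Unitary.conjStarAlgAut_apply, Matrix.star_eq_conjTranspose,
      Matrix.conjTranspose_eq_transpose_of_trivial, Function.comp_def] using this
  refine ⟨B * U, hE.eigenvalues, hBu.mul ?_, ?_, ?_⟩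
  · exact IsUnit.of_mul_eq_one _ hU'
  · rw [Matrix.transpose_mul, hB]
    calc B * Bᵀ = B * (U * Uᵀ) * Bᵀ := by rw [hU', mul_one]
      _ = _ := by simp only [mul_assoc]
  · calc D = (B * B⁻¹) * D * (B * B⁻¹)ᵀ := by simp [hBi]
      _ = B * (B⁻¹ * D * (B⁻¹)ᵀ) * Bᵀ := by simp only [Matrix.transpose_mul, mul_assoc]
      _ = B * (U * Matrix.diagonal hE.eigenvalues * Uᵀ) * Bᵀ := congrArg (B * · * Bᵀ) hsp
      _ = _ := by simp only [Matrix.transpose_mul, mul_assoc]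

lemma posDef_congr_diagonal_iff {W : Matrix ι ι ℝ} (hW : IsUnit W) (x : ι → ℝ) :
    (W * Matrix.diagonal x * Wᵀ).PosDef ↔ ∀ i, 0 < x i := by
  have := Matrix.IsUnit.posDef_star_right_conjugate_iff (x := Matrix.diagonal x) hW
  rw [Matrix.star_eq_conjTranspose, Matrix.conjTranspose_eq_transpose_of_trivial] at this
  rw [this, Matrix.posDef_diagonal_iff]

/-- The loss at a covariance matrix that is diagonal in the frame `W`. -/
lemma gaussLoss_congr_diagonal (A : Matrix ι ι ℝ) {W : Matrix ι ι ℝ} (hW : IsUnit W)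
    {x : ι → ℝ} (hx : ∀ i, 0 < x i) :
    gaussLoss A (W * Matrix.diagonal x * Wᵀ) =
      ∑ i, ((W⁻¹ * A * W⁻¹ᵀ) i i / x i + Real.log (x i)) + Real.log |(W * Wᵀ).det| := by
  have hWd : IsUnit W.det := (Matrix.isUnit_iff_isUnit_det _).1 hW
  have h1 : (A * (W * Matrix.diagonal x * Wᵀ)⁻¹).trace =
      ∑ i, (W⁻¹ * A * W⁻¹ᵀ) i i / x i := by
    have hinv : (Matrix.diagonal x)⁻¹ = Matrix.diagonal (fun i => (x i)⁻¹) := by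
      refine Matrix.inv_eq_right_inv ?_
      rw [Matrix.diagonal_mul_diagonal, ← Matrix.diagonal_one]
      congr 1
      ext i
      exact mul_inv_cancel₀ (hx i).ne'
    rw [Matrix.mul_inv_rev, Matrix.mul_inv_rev, hinv, ← mul_assoc, ← mul_assoc,
      Matrix.trace_mul_comm, ← mul_assoc, ← mul_assoc, ← Matrix.transpose_nonsing_inv]
    simp [Matrix.trace, Matrix.mul_diagonal, div_eq_mul_inv]
  have h2 : Real.log |(W * Matrix.diagonal x * Wᵀ).det| =
      ∑ i, Real.log (x i) + Real.log |(W * Wᵀ).det| := by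
    have h3 : ∏ i, x i ≠ 0 := (Finset.prod_pos fun i _ => hx i).ne'
    have h4 : W.det * W.det ≠ 0 := mul_ne_zero hWd.ne_zero hWd.ne_zero
    rw [← Real.log_prod (fun i _ => (hx i).ne'), Real.log_abs, Real.log_abs,
      ← Real.log_mul h3 (by simpa using h4)]
    congr 1
    simp only [Matrix.det_mul, Matrix.det_diagonal, Matrix.det_transpose]
    ring
  rw [gaussLoss, h1, h2, Finset.sum_add_distrib, add_assoc]

lemma div_add_log_midpoint_lt {a x y : ℝ} (hx : 0 < x) (hy : 0 < y) (hxy : x ≠ y)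
    (ha : x + y < 4 * a) :
    2 * (a / ((x + y) / 2) + Real.log ((x + y) / 2)) <
      (a / x + Real.log x) + (a / y + Real.log y) := by
  have h1 : 2 * Real.log ((x + y) / 2) - Real.log x - Real.log y ≤ (x - y) ^ 2 / (4 * x * y) := by
    have h2 : 2 * Real.log ((x + y) / 2) - Real.log x - Real.log y =
        Real.log (((x + y) / 2) ^ 2 / x / y) := by
      rw [Real.log_div (by positivity) hy.ne', Real.log_div (by positivity) hx.ne', Real.log_pow]
      norm_num
    rw [h2]
    refine (Real.log_le_sub_one_of_pos (by positivity)).trans (le_of_eq ?_)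
    field_simp
    ring
  have h3 : a / x + a / y - 2 * (a / ((x + y) / 2)) - (x - y) ^ 2 / (4 * x * y) =
      (x - y) ^ 2 * (4 * a - (x + y)) / (4 * x * y * (x + y)) := by
    field_simp
    ring
  have h4 : 0 < (x - y) ^ 2 * (4 * a - (x + y)) / (4 * x * y * (x + y)) := by
    have : 0 < (x - y) ^ 2 := by
      have := sub_ne_zero.2 hxy
      positivity
    have : 0 < 4 * a - (x + y) := by linarith
    positivity
  linarith

/-- Strict midpoint convexity of the loss on the region where the covariance is small compared to
the second moment matrix. -/
lemma gaussLoss_midpoint_lt {A M₁ M₂ : Matrix ι ι ℝ} (h₁ : M₁.PosDef) (h₂ : M₂.PosDef)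
    (hne : M₁ ≠ M₂) (hA : ((4 : ℝ) • A - (M₁ + M₂)).PosDef) :
    2 * gaussLoss A ((1 / 2 : ℝ) • (M₁ + M₂)) < gaussLoss A M₁ + gaussLoss A M₂ := by
  obtain ⟨W, x, hW, hM₁, hM₂⟩ := h₁.exists_simultaneous_diagonal h₂.isHermitian
  have hWd : IsUnit W.det := (Matrix.isUnit_iff_isUnit_det _).1 hW
  have hx : ∀ i, 0 < x i := (posDef_congr_diagonal_iff hW x).1 (hM₂ ▸ h₂)
  have hM₁' : M₁ = W * Matrix.diagonal (fun _ => 1) * Wᵀ := by simp [hM₁]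
  have hmid : (1 / 2 : ℝ) • (M₁ + M₂) = W * Matrix.diagonal (fun i => (1 + x i) / 2) * Wᵀ := by
    have : Matrix.diagonal (fun i => (1 + x i) / 2) =
        (1 / 2 : ℝ) • (Matrix.diagonal (fun _ => (1 : ℝ)) + Matrix.diagonal x) := by
      rw [Matrix.diagonal_add, ← Matrix.diagonal_smul]
      congr 1
      ext i
      simp
      ring
    rw [this, hM₁', hM₂, Matrix.mul_smul, Matrix.smul_mul, Matrix.mul_add, Matrix.add_mul]
  have hL₁ := gaussLoss_congr_diagonal A hW (x := fun _ => 1) (fun i => one_pos)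
  have hL₂ := gaussLoss_congr_diagonal A hW hx
  rw [← hM₁'] at hL₁
  rw [← hM₂] at hL₂
  rw [hmid, gaussLoss_congr_diagonal A hW (fun i => by linarith [hx i]), hL₁, hL₂]
  set a : ι → ℝ := fun i => (W⁻¹ * A * W⁻¹ᵀ) i i with ha
  have ha4 : ∀ i, 1 + x i < 4 * a i := by
    intro i
    have hWi : IsUnit W⁻¹ := by simpa using hW
    have h5 := (Matrix.IsUnit.posDef_star_right_conjugate_iff hWi).2 hA
    rw [Matrix.star_eq_conjTranspose, Matrix.conjTranspose_eq_transpose_of_trivial] at h5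
    have h7 : W⁻¹ * W = 1 := Matrix.nonsing_inv_mul _ hWd
    have h6 : W⁻¹ * ((4 : ℝ) • A - (M₁ + M₂)) * W⁻¹ᵀ =
        (4 : ℝ) • (W⁻¹ * A * W⁻¹ᵀ) - (1 + Matrix.diagonal x) := by
      have e : ∀ D : Matrix ι ι ℝ, W⁻¹ * (W * D * Wᵀ) * W⁻¹ᵀ = D := by
        intro D
        calc W⁻¹ * (W * D * Wᵀ) * W⁻¹ᵀ = (W⁻¹ * W) * D * (W⁻¹ * W)ᵀ := by
              simp only [Matrix.transpose_mul, mul_assoc]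
          _ = D := by simp [h7]
      rw [Matrix.mul_sub, Matrix.sub_mul, Matrix.mul_smul, Matrix.smul_mul, Matrix.mul_add,
        Matrix.add_mul, hM₁', hM₂, e, e, Matrix.diagonal_one]
    rw [h6] at h5
    have := h5.diag_pos (i := i)
    simp only [Matrix.sub_apply, Matrix.smul_apply, Matrix.add_apply, Matrix.one_apply_eq,
      Matrix.diagonal_apply_eq, smul_eq_mul] at this
    show 1 + x i < 4 * (W⁻¹ * A * W⁻¹ᵀ) i i
    linarith
  obtain ⟨k, hk⟩ : ∃ k, x k ≠ 1 := by
    by_contra! h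
    exact hne (by rw [hM₁', hM₂, show x = fun _ => 1 from funext h])
  have key : 2 * ∑ i, (a i / ((1 + x i) / 2) + Real.log ((1 + x i) / 2)) <
      ∑ i, (a i / 1 + Real.log 1) + ∑ i, (a i / x i + Real.log (x i)) := by
    rw [Finset.mul_sum, ← Finset.sum_add_distrib]
    refine Finset.sum_lt_sum (fun i _ => ?_) ⟨k, Finset.mem_univ _, ?_⟩
    · by_cases h : x i = 1
      · rw [h]; norm_num; linarith
      · exact (div_add_log_midpoint_lt one_pos (hx i) (Ne.symm h) (ha4 i)).le
    · exact div_add_log_midpoint_lt one_pos (hx k) (Ne.symm hk) (ha4 k)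
  linarith

lemma exists_pos_forall_abs_sub_one_lt {ε : ℝ} (hε : 0 < ε) :
    ∃ δ > 0, ∀ x : ℝ, 0 < x → 1 / x + Real.log x - 1 ≤ δ → |x - 1| < ε := by
  have hc : ContinuousAt (fun s : ℝ => 1 / s ^ 2) 1 := by
    refine ContinuousAt.div continuousAt_const (by fun_prop) (by norm_num)
  obtain ⟨η, hη, h⟩ := Metric.continuousAt_iff.1 hc ε hε
  refine ⟨(η / 2) ^ 2, by positivity, fun x hx hle => ?_⟩
  have hs : 0 < √x := Real.sqrt_pos.2 hx
  have hsq : √x ^ 2 = x := Real.sq_sqrt hx.le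
  have h1 : (1 / √x - 1) ^ 2 ≤ 1 / x + Real.log x - 1 := by
    have h2 := Real.log_le_sub_one_of_pos (show 0 < 1 / √x by positivity)
    have h3 : Real.log (1 / √x) = - (Real.log x / 2) := by
      rw [one_div, Real.log_inv, Real.log_sqrt hx.le]
    have h4 : (1 / √x) ^ 2 = 1 / x := by rw [div_pow, hsq, one_pow]
    nlinarith
  have h5 : |1 / √x - 1| ≤ η / 2 := abs_le_of_sq_le_sq (h1.trans hle) (by positivity)
  have h6 := h (x := 1 / √x) (by rw [Real.dist_eq]; linarith)
  have h7 : 1 / (1 / √x) ^ 2 = x := by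
    rw [div_pow, hsq]; simp
  simp only [h7, Real.dist_eq, one_pow, div_one] at h6
  exact h6

lemma one_div_add_log_sub_one_nonneg {x : ℝ} (hx : 0 < x) : 0 ≤ 1 / x + Real.log x - 1 := by
  have := Real.log_le_sub_one_of_pos (show 0 < 1 / x by positivity)
  rw [one_div, Real.log_inv, ← one_div] at this
  linarith

/-- A covariance matrix whose loss is close to the minimum lies close to the second moment
matrix, in the order of positive definite matrices. -/
lemma exists_pos_posDef_of_gaussLoss_le {ε : ℝ} (hε : 0 < ε) :
    ∃ δ > 0, ∀ A M : Matrix ι ι ℝ, A.PosDef → M.PosDef →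
      gaussLoss A M ≤ gaussLoss A A + δ →
        (M - (1 - ε) • A).PosDef ∧ ((1 + ε) • A - M).PosDef := by
  obtain ⟨δ, hδ, h⟩ := exists_pos_forall_abs_sub_one_lt hε
  refine ⟨δ, hδ, fun A M hA hM hle => ?_⟩
  obtain ⟨W, x, hW, hAW, hMW⟩ := hA.exists_simultaneous_diagonal hM.isHermitian
  have hWd : IsUnit W.det := (Matrix.isUnit_iff_isUnit_det _).1 hW
  have hx : ∀ i, 0 < x i := (posDef_congr_diagonal_iff hW x).1 (hMW ▸ hM)
  have hAW' : A = W * Matrix.diagonal (fun _ => 1) * Wᵀ := by simp [hAW]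
  have hWA : W⁻¹ * A * W⁻¹ᵀ = 1 := by
    have h7 : W⁻¹ * W = 1 := Matrix.nonsing_inv_mul _ hWd
    calc W⁻¹ * A * W⁻¹ᵀ = (W⁻¹ * W) * (W⁻¹ * W)ᵀ := by
          rw [hAW]; simp only [Matrix.transpose_mul, mul_assoc]
      _ = 1 := by simp [h7]
  have hA0 := gaussLoss_congr_diagonal A hW (x := fun _ => 1) (fun i => one_pos)
  have hM0 := gaussLoss_congr_diagonal A hW hx
  rw [← hAW', hWA] at hA0
  rw [← hMW, hWA] at hM0
  have hsum : ∑ i, (1 / x i + Real.log (x i) - 1) ≤ δ := by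
    rw [hA0, hM0] at hle
    simp only [Matrix.one_apply_eq] at hle
    rw [Finset.sum_sub_distrib]
    simp only [div_one, Real.log_one, add_zero] at hle
    linarith
  have hxi : ∀ i, |x i - 1| < ε := fun i => h _ (hx i) <|
    (Finset.single_le_sum (f := fun i => 1 / x i + Real.log (x i) - 1)
      (fun j _ => one_div_add_log_sub_one_nonneg (hx j)) (Finset.mem_univ i)).trans hsum
  constructor
  · have : M - (1 - ε) • A = W * Matrix.diagonal (fun i => x i - (1 - ε)) * Wᵀ := by
      have e : Matrix.diagonal (fun i => x i - (1 - ε)) =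
          Matrix.diagonal x - (1 - ε) • (1 : Matrix ι ι ℝ) := by
        ext i j; by_cases hij : i = j <;> simp [hij, Matrix.diagonal]
      rw [e, hMW, hAW, Matrix.mul_sub, Matrix.sub_mul]
      simp
    rw [this, posDef_congr_diagonal_iff hW]
    intro i
    linarith [(abs_lt.1 (hxi i)).1]
  · have : (1 + ε) • A - M = W * Matrix.diagonal (fun i => (1 + ε) - x i) * Wᵀ := by
      have e : Matrix.diagonal (fun i => (1 + ε) - x i) =
          (1 + ε) • (1 : Matrix ι ι ℝ) - Matrix.diagonal x := by
        ext i j; by_cases hij : i = j <;> simp [hij, Matrix.diagonal]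
      rw [e, hMW, hAW, Matrix.mul_sub, Matrix.sub_mul]
      simp
    rw [this, posDef_congr_diagonal_iff hW]
    intro i
    linarith [(abs_lt.1 (hxi i)).2]

lemma Matrix.PosSemidef.abs_apply_le {B D : Matrix ι ι ℝ} (h₁ : (B + D).PosSemidef)
    (h₂ : (B - D).PosSemidef) (i j : ι) : |D i j| ≤ (B i i + B j j) / 2 := by
  have hp := h₁.isHermitian.apply i j
  have hm := h₂.isHermitian.apply i j
  simp only [star_trivial, Matrix.add_apply, Matrix.sub_apply] at hp hm
  have e : ∀ (Q : Matrix ι ι ℝ) (s : ℝ),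
      (Pi.single i 1 + s • Pi.single j 1) ⬝ᵥ (Q *ᵥ (Pi.single i 1 + s • Pi.single j 1)) =
        Q i i + s * Q i j + s * Q j i + s ^ 2 * Q j j := by
    intro Q s
    simp [Matrix.mulVec_add, Matrix.mulVec_smul, add_dotProduct, dotProduct_add]
    ring
  have a1 := h₁.dotProduct_mulVec_nonneg (Pi.single i 1 + (1 : ℝ) • Pi.single j 1)
  have a2 := h₁.dotProduct_mulVec_nonneg (Pi.single i 1 + (-1 : ℝ) • Pi.single j 1)
  have a3 := h₂.dotProduct_mulVec_nonneg (Pi.single i 1 + (1 : ℝ) • Pi.single j 1)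
  have a4 := h₂.dotProduct_mulVec_nonneg (Pi.single i 1 + (-1 : ℝ) • Pi.single j 1)
  rw [star_trivial, e] at a1 a2 a3 a4
  simp only [Matrix.add_apply, Matrix.sub_apply] at a1 a2 a3 a4
  rw [abs_le]
  constructor <;> linarith

lemma continuousAt_gaussLoss_right (A : Matrix ι ι ℝ) {M : Matrix ι ι ℝ} (hM : M.det ≠ 0) :
    ContinuousAt (gaussLoss A) M := by
  have h1 : ContinuousAt (fun M : Matrix ι ι ℝ => M⁻¹) M := by
    refine continuousAt_matrix_inv M ?_
    have : (Ring.inverse : ℝ → ℝ) = fun x => x⁻¹ := by ext; simp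
    rw [this]
    exact continuousAt_inv₀ hM
  have h2 : ContinuousAt (fun N : Matrix ι ι ℝ => (A * N).trace) M⁻¹ :=
    (Continuous.matrix_trace (by fun_prop)).continuousAt
  have h3 : ContinuousAt (fun M : Matrix ι ι ℝ => Real.log |M.det|) M := by
    simp only [Real.log_abs]
    exact (Continuous.matrix_det continuous_id).continuousAt.log hM
  exact (ContinuousAt.comp (f := fun M : Matrix ι ι ℝ => M⁻¹) h2 h1).add h3

lemma continuousAt_gaussLoss_left (A M : Matrix ι ι ℝ) :
    ContinuousAt (fun A => gaussLoss A M) A :=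
  ((Continuous.matrix_trace (by fun_prop)).continuousAt).add continuousAt_const

/-- The excess loss of a fixed covariance matrix tends to zero as the second moment matrix
approaches it. -/
lemma eventually_gaussLoss_le {M₀ : Matrix ι ι ℝ} (hM₀ : M₀.PosDef) {δ : ℝ} (hδ : 0 < δ) :
    ∀ᶠ A in nhds M₀, A.PosSemidef → A.PosDef ∧ gaussLoss A M₀ ≤ gaussLoss A A + δ := by
  have hdet : M₀.det ≠ 0 := hM₀.det_pos.ne'
  have hcd : ContinuousAt (fun A : Matrix ι ι ℝ => A.det) M₀ :=
    (Continuous.matrix_det continuous_id).continuousAt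
  have h1 : ∀ᶠ A in nhds M₀, A.det ≠ 0 := hcd.eventually_ne hdet
  have h2 : ContinuousAt (fun A : Matrix ι ι ℝ =>
      gaussLoss A M₀ - (Fintype.card ι + Real.log A.det)) M₀ :=
    (continuousAt_gaussLoss_left M₀ M₀).sub (continuousAt_const.add (hcd.log hdet))
  have hself : ∀ A : Matrix ι ι ℝ, A.det ≠ 0 →
      gaussLoss A A = Fintype.card ι + Real.log A.det := by
    intro A hA
    rw [gaussLoss, Matrix.mul_nonsing_inv _ (isUnit_iff_ne_zero.2 hA), Matrix.trace_one,
      Real.log_abs]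
  have h3 := h2.eventually_lt (continuousAt_const (y := δ))
    (by rw [hself _ hdet, sub_self]; exact hδ)
  filter_upwards [h1, h3] with A hA1 hA3 hA
  exact ⟨hA.posDef_iff_det_ne_zero.2 hA1, by rw [hself A hA1]; linarith⟩

end MatrixLoss

section Deterministic

variable {m n : ℕ}

lemma pairProducts_mulVec (S : Matrix (Fin m) (Fin n) ℝ) (d : Fin n → ℝ) (q : PairIndex m) :
    (pairProducts S *ᵥ d) q = (S * Matrix.diagonal d * Sᵀ) q.1.1 q.1.2 := by
  simp only [pairProducts, Matrix.mulVec, dotProduct, Matrix.of_apply, Matrix.mul_apply (N := Sᵀ),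
    Matrix.mul_diagonal, Matrix.transpose_apply]
  exact Finset.sum_congr rfl fun j _ => by ring

lemma mul_diagonal_mul_transpose_comm (S : Matrix (Fin m) (Fin n) ℝ) (d : Fin n → ℝ)
    (a b : Fin m) : (S * Matrix.diagonal d * Sᵀ) a b = (S * Matrix.diagonal d * Sᵀ) b a := by
  have : (S * Matrix.diagonal d * Sᵀ)ᵀ = S * Matrix.diagonal d * Sᵀ := by
    simp [Matrix.transpose_mul, Matrix.mul_assoc]
  conv_lhs => rw [← this, Matrix.transpose_apply]

lemma mul_diagonal_mul_transpose_eq_iff (S : Matrix (Fin m) (Fin n) ℝ) (d e : Fin n → ℝ) :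
    S * Matrix.diagonal d * Sᵀ = S * Matrix.diagonal e * Sᵀ ↔
      pairProducts S *ᵥ d = pairProducts S *ᵥ e := by
  constructor
  · intro h
    ext q
    rw [pairProducts_mulVec, pairProducts_mulVec, h]
  · intro h
    ext a b
    rcases le_total a b with hab | hab
    · have := congrFun h ⟨(a, b), hab⟩
      rwa [pairProducts_mulVec, pairProducts_mulVec] at this
    · have := congrFun h ⟨(b, a), hab⟩
      rw [pairProducts_mulVec, pairProducts_mulVec] at this
      rw [mul_diagonal_mul_transpose_comm S d, mul_diagonal_mul_transpose_comm S e]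
      exact this

lemma covOf_eq_iff (S : Matrix (Fin m) (Fin n) ℝ) (C : Matrix (Fin m) (Fin m) ℝ)
    (p q : Fin n → ℝ) : covOf S C p = covOf S C q ↔ pairProducts S *ᵥ p = pairProducts S *ᵥ q := by
  rw [covOf, covOf, add_left_inj, mul_diagonal_mul_transpose_eq_iff]

lemma pairProducts_mulVec_injective_of_rank {S : Matrix (Fin m) (Fin n) ℝ}
    (h : (pairProducts S).rank = n) : Function.Injective (pairProducts S *ᵥ ·) := by
  have h1 := (pairProducts S).mulVecLin.finrank_range_add_finrank_ker
  rw [Matrix.rank] at h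
  rw [h, Module.finrank_fin_fun] at h1
  have h2 : Module.finrank ℝ (LinearMap.ker (pairProducts S).mulVecLin) = 0 := by omega
  exact LinearMap.ker_eq_bot.1 (Submodule.finrank_eq_zero.1 h2)

lemma rank_pairProducts_of_injective {S : Matrix (Fin m) (Fin n) ℝ}
    (h : Function.Injective (pairProducts S *ᵥ ·)) : (pairProducts S).rank = n := by
  rw [Matrix.rank, LinearMap.finrank_range_of_inj (f := (pairProducts S).mulVecLin) h,
    Module.finrank_fin_fun]

lemma exists_pairProducts_mulVec_eq_zero {S : Matrix (Fin m) (Fin n) ℝ}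
    (h : (pairProducts S).rank ≠ n) : ∃ d ≠ 0, pairProducts S *ᵥ d = 0 := by
  by_contra! hd
  refine h (rank_pairProducts_of_injective ?_)
  refine (injective_iff_map_eq_zero (pairProducts S).mulVecLin).2 fun d hd0 => ?_
  by_contra hne
  exact hd d hne hd0

/-- The second moment matrix about `μ` of the first `L` observations. -/
noncomputable def sampleMoment (μ : EuclideanSpace ℝ (Fin m)) (L : ℕ)
    (y : ℕ → EuclideanSpace ℝ (Fin m)) : Matrix (Fin m) (Fin m) ℝ :=
  (1 / (L : ℝ)) • ∑ i ∈ Finset.range L, Matrix.vecMulVec (y i - μ).ofLp (y i - μ).ofLp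

lemma sampleMoment_posSemidef (μ : EuclideanSpace ℝ (Fin m)) (L : ℕ)
    (y : ℕ → EuclideanSpace ℝ (Fin m)) : (sampleMoment μ L y).PosSemidef := by
  refine Matrix.PosSemidef.smul (Matrix.posSemidef_sum _ fun i _ => ?_) (by positivity)
  simpa using Matrix.posSemidef_vecMulVec_self_star (y i - μ).ofLp

lemma mlObjective_eq_gaussLoss (S : Matrix (Fin m) (Fin n) ℝ) (C : Matrix (Fin m) (Fin m) ℝ)
    (μ : EuclideanSpace ℝ (Fin m)) (L : ℕ) (y : ℕ → EuclideanSpace ℝ (Fin m)) (p : Fin n → ℝ) :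
    mlObjective S C μ L y p = gaussLoss (sampleMoment μ L y) (covOf S C p) := by
  rw [mlObjective, gaussLoss, sampleMoment, Matrix.smul_mul, Matrix.trace_smul, Finset.sum_mul,
    Matrix.trace_sum, smul_eq_mul]
  congr 2
  refine Finset.sum_congr rfl fun i _ => ?_
  rw [Matrix.trace_mul_comm, Matrix.mul_vecMulVec, Matrix.trace_vecMulVec, dotProduct_comm]

lemma isClosed_setOf_posSemidef {ι : Type*} [Fintype ι] :
    IsClosed {M : Matrix ι ι ℝ | M.PosSemidef} := by
  simp only [Matrix.posSemidef_iff_dotProduct_mulVec, Set.ofPred_and, Set.ofPred_forall]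
  refine IsClosed.inter (isClosed_eq (by fun_prop) continuous_id) (isClosed_iInter fun x => ?_)
  refine isClosed_le continuous_const ?_
  fun_prop

lemma continuous_covOf (S : Matrix (Fin m) (Fin n) ℝ) (C : Matrix (Fin m) (Fin m) ℝ) :
    Continuous (covOf S C) := by
  unfold covOf
  fun_prop

lemma covOf_midpoint (S : Matrix (Fin m) (Fin n) ℝ) (C : Matrix (Fin m) (Fin m) ℝ)
    (p q : Fin n → ℝ) :
    covOf S C ((1 / 2 : ℝ) • (p + q)) = (1 / 2 : ℝ) • (covOf S C p + covOf S C q) := by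
  have : Matrix.diagonal ((1 / 2 : ℝ) • (p + q)) =
      (1 / 2 : ℝ) • (Matrix.diagonal p + Matrix.diagonal q) := by
    rw [Matrix.diagonal_smul, Matrix.diagonal_add]; rfl
  simp only [covOf, this, Matrix.mul_smul, Matrix.smul_mul, Matrix.mul_add, Matrix.add_mul]
  module

lemma isCompact_setOf_covOf_between {S : Matrix (Fin m) (Fin n) ℝ} (C : Matrix (Fin m) (Fin m) ℝ)
    (hinj : Function.Injective (pairProducts S *ᵥ ·)) {A B : Matrix (Fin m) (Fin m) ℝ}
    (hA : A.PosSemidef) :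
    IsCompact {p | (covOf S C p - A).PosSemidef ∧ (B - covOf S C p).PosSemidef} := by
  refine Metric.isCompact_of_isClosed_isBounded ?_ ?_
  · exact (isClosed_setOf_posSemidef.preimage ((continuous_covOf S C).sub continuous_const)).inter
      (isClosed_setOf_posSemidef.preimage (continuous_const.sub (continuous_covOf S C)))
  · obtain ⟨K, -, hK⟩ := (pairProducts S).mulVecLin.exists_antilipschitzWith
      (LinearMap.ker_eq_bot.2 hinj)
    refine (hK.isBounded_preimage (s := Set.Icc
      (fun q => -((B q.1.1 q.1.1 + B q.1.2 q.1.2) / 2) - C q.1.1 q.1.2)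
      (fun q => (B q.1.1 q.1.1 + B q.1.2 q.1.2) / 2 - C q.1.1 q.1.2))
      (Metric.isBounded_Icc _ _)).subset ?_
    rintro p ⟨hp1, hp2⟩
    have hM : (covOf S C p).PosSemidef := by simpa using hp1.add hA
    have hle := Matrix.PosSemidef.abs_apply_le (B := B) (D := covOf S C p)
      (by simpa [add_assoc, ← two_smul ℝ] using (hp2.add hM).add hM) hp2
    have hq : ∀ q : PairIndex m, (pairProducts S *ᵥ p) q =
        covOf S C p q.1.1 q.1.2 - C q.1.1 q.1.2 := by
      intro q
      rw [pairProducts_mulVec, covOf, Matrix.add_apply, add_sub_cancel_right]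
    constructor
    · intro q
      have := (abs_le.1 (hle q.1.1 q.1.2)).1
      rw [Matrix.mulVecLin_apply, hq]
      linarith
    · intro q
      have := (abs_le.1 (hle q.1.1 q.1.2)).2
      rw [Matrix.mulVecLin_apply, hq]
      linarith

/-- If the sample second moment matrix is close to the true covariance matrix, the estimation over
a closed convex set of powers that contains the true ones has a unique solution. -/
lemma eventually_existsUnique_minimizer {S : Matrix (Fin m) (Fin n) ℝ}
    {C : Matrix (Fin m) (Fin m) ℝ} (hinj : Function.Injective (pairProducts S *ᵥ ·))
    {K : Set (Fin n → ℝ)} (hK : IsClosed K) (hKc : Convex ℝ K) {p₀ : Fin n → ℝ} (hp₀K : p₀ ∈ K)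
    (hp₀ : p₀ ∈ admissible S C) :
    ∀ᶠ A in nhds (covOf S C p₀), A.PosSemidef →
      ∃! p, p ∈ K ∩ admissible S C ∧ ∀ q ∈ K ∩ admissible S C,
        gaussLoss A (covOf S C p) ≤ gaussLoss A (covOf S C q) := by
  obtain ⟨δ, hδ, hsand⟩ :=
    exists_pos_posDef_of_gaussLoss_le (ι := Fin m) (show (0 : ℝ) < 1 / 2 by norm_num)
  filter_upwards [eventually_gaussLoss_le hp₀ hδ] with A hA hAs
  obtain ⟨hAp, hA0⟩ := hA hAs
  have hA1 : ((1 - 1 / 2 : ℝ) • A).PosDef := hAp.smul (by norm_num)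
  set R := {p | (covOf S C p - (1 - 1 / 2 : ℝ) • A).PosSemidef ∧
    ((1 + 1 / 2 : ℝ) • A - covOf S C p).PosSemidef} with hR
  have hRadm : ∀ p ∈ R, p ∈ admissible S C := fun p hp => by
    show (covOf S C p).PosDef
    simpa using hA1.posSemidef_add hp.1
  have hsub : ∀ q ∈ admissible S C, gaussLoss A (covOf S C q) ≤ gaussLoss A A + δ → q ∈ R :=
    fun q hq hle => ⟨(hsand A _ hAp hq hle).1.posSemidef, (hsand A _ hAp hq hle).2.posSemidef⟩
  have hp₀R : p₀ ∈ R := hsub _ hp₀ hA0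
  have hcomp : IsCompact (K ∩ R) :=
    (isCompact_setOf_covOf_between C hinj hA1.posSemidef).inter_left hK
  have hcont : ContinuousOn (fun p => gaussLoss A (covOf S C p)) (K ∩ R) := by
    intro p hp
    refine ContinuousAt.continuousWithinAt ?_
    have hpos : (covOf S C p).PosDef := hRadm p hp.2
    exact ContinuousAt.comp (continuousAt_gaussLoss_right A hpos.det_pos.ne')
      (continuous_covOf S C).continuousAt
  obtain ⟨p, hpR, hp⟩ := hcomp.exists_isMinOn ⟨p₀, hp₀K, hp₀R⟩ hcont
  have hpmin : ∀ q ∈ K ∩ admissible S C,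
      gaussLoss A (covOf S C p) ≤ gaussLoss A (covOf S C q) := by
    intro q hq
    by_cases hle : gaussLoss A (covOf S C q) ≤ gaussLoss A A + δ
    · exact hp ⟨hq.1, hsub q hq.2 hle⟩
    · exact (hp ⟨hp₀K, hp₀R⟩).trans (hA0.trans (not_le.1 hle).le)
  refine ⟨p, ⟨⟨hpR.1, hRadm p hpR.2⟩, hpmin⟩, ?_⟩
  rintro q ⟨⟨hqK, hqa⟩, hqmin⟩
  by_contra hne
  have hpa := hRadm p hpR.2
  have hqp := hqmin p ⟨hpR.1, hpa⟩
  have hqR : q ∈ R := hsub q hqa (hqp.trans ((hp ⟨hp₀K, hp₀R⟩).trans hA0))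
  have hMne : covOf S C p ≠ covOf S C q := fun h => hne (hinj ((covOf_eq_iff S C p q).1 h)).symm
  have h4 : ((4 : ℝ) • A - (covOf S C p + covOf S C q)).PosDef := by
    have : (4 : ℝ) • A - (covOf S C p + covOf S C q) =
        A + (((1 + 1 / 2 : ℝ) • A - covOf S C p) + ((1 + 1 / 2 : ℝ) • A - covOf S C q)) := by
      module
    rw [this]
    exact hAp.add_posSemidef (hpR.2.2.add hqR.2)
  have hlt := gaussLoss_midpoint_lt hpa hqa hMne h4
  rw [← covOf_midpoint] at hlt
  have hmidK : (1 / 2 : ℝ) • (p + q) ∈ K := by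
    rw [smul_add]
    exact hKc hpR.1 hqK (by norm_num) (by norm_num) (by norm_num)
  have hmida : (1 / 2 : ℝ) • (p + q) ∈ admissible S C := by
    show (covOf S C _).PosDef
    rw [covOf_midpoint]
    exact (Matrix.PosDef.add hpa hqa).smul (by norm_num)
  have := hpmin _ ⟨hmidK, hmida⟩
  linarith [hpmin q ⟨hqK, hqa⟩]

/-- Powers that produce a covariance matrix close to that of `p₀` can be replaced by powers close to
`p₀` with the same covariance matrix. -/
lemma exists_near_of_covOf_near (S : Matrix (Fin m) (Fin n) ℝ) (C : Matrix (Fin m) (Fin m) ℝ)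
    {p₀ : Fin n → ℝ} {U : Set (Fin n → ℝ)} (hU : U ∈ nhds p₀) :
    ∃ ε > 0, ∀ p, (∀ a b, |covOf S C p a b - covOf S C p₀ a b| < ε) →
      ∃ p' ∈ U, covOf S C p' = covOf S C p := by
  set T := (pairProducts S).mulVecLin with hT
  obtain ⟨g, hg⟩ := T.rangeRestrict.exists_rightInverse_of_surjective T.range_rangeRestrict
  have hgc : Continuous g := g.continuous_of_finiteDimensional
  have htend : ContinuousAt (fun y => p₀ + g y) 0 := by fun_prop
  have hUn : (fun y => p₀ + g y) ⁻¹' U ∈ nhds 0 := htend (by simpa using hU)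
  obtain ⟨ε, hε, hball⟩ := Metric.mem_nhds_iff.1 hUn
  refine ⟨ε, hε, fun p hp => ⟨p₀ + g (T.rangeRestrict (p - p₀)), ?_, ?_⟩⟩
  · refine hball ?_
    rw [mem_ball_zero_iff]
    show ‖T (p - p₀)‖ < ε
    rw [pi_norm_lt_iff hε]
    intro q
    rw [map_sub, Pi.sub_apply, Matrix.mulVecLin_apply, Matrix.mulVecLin_apply, pairProducts_mulVec,
      pairProducts_mulVec, Real.norm_eq_abs]
    have := hp q.1.1 q.1.2
    rwa [covOf, covOf, Matrix.add_apply, Matrix.add_apply, add_sub_add_right_eq_sub] at this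
  · rw [covOf_eq_iff]
    have h1 : T (g (T.rangeRestrict (p - p₀))) = T (p - p₀) :=
      congrArg Subtype.val (LinearMap.congr_fun hg (T.rangeRestrict (p - p₀)))
    show T (p₀ + g (T.rangeRestrict (p - p₀))) = T p
    rw [map_add, h1, ← map_add, add_sub_cancel]

lemma eventually_rank_of_existsUnique_minimizer {S : Matrix (Fin m) (Fin n) ℝ}
    {C : Matrix (Fin m) (Fin m) ℝ} {K : Set (Fin n → ℝ)} {p₀ : Fin n → ℝ}
    (hK : K ∈ nhds p₀) (hp₀ : p₀ ∈ admissible S C) :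
    ∀ᶠ A in nhds (covOf S C p₀), A.PosSemidef →
      (∃! p, p ∈ K ∩ admissible S C ∧ ∀ q ∈ K ∩ admissible S C,
        gaussLoss A (covOf S C p) ≤ gaussLoss A (covOf S C q)) → (pairProducts S).rank = n := by
  obtain ⟨ε, hε, hnear⟩ := exists_near_of_covOf_near S C (interior_mem_nhds.2 hK)
  set M₀ := covOf S C p₀ with hM₀
  set t : ℝ := ∑ a, (M₀ a a + 1) with ht
  have hdiag : ∀ a, 0 ≤ M₀ a a := fun a => Matrix.PosSemidef.diag_nonneg
    (Matrix.PosDef.posSemidef hp₀)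
  have ht0 : 0 ≤ t := Finset.sum_nonneg fun a _ => by linarith [hdiag a]
  have hη : 0 < ε / 2 / (t + 1) := by positivity
  obtain ⟨δ, hδ, hsand⟩ := exists_pos_posDef_of_gaussLoss_le (ι := Fin m) hη
  have hentry : ∀ᶠ A in nhds M₀, ∀ a b, |A a b - M₀ a b| < min (ε / 2) 1 := by
    refine eventually_all.2 fun a => eventually_all.2 fun b => ?_
    have hc : ContinuousAt (fun A : Matrix (Fin m) (Fin m) ℝ => |A a b - M₀ a b|) M₀ :=
      ((continuous_id.matrix_elem a b).sub continuous_const).abs.continuousAt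
    refine hc.eventually_lt continuousAt_const ?_
    simp only [sub_self, abs_zero]
    positivity
  filter_upwards [eventually_gaussLoss_le hp₀ hδ, hentry] with A hA hAe hAs
  obtain ⟨hAp, hA0⟩ := hA hAs
  rintro ⟨p, ⟨⟨hpK, hpa⟩, hpmin⟩, huniq⟩
  obtain ⟨h1, h2⟩ := hsand A _ hAp hpa ((hpmin p₀ ⟨mem_of_mem_nhds hK, hp₀⟩).trans hA0)
  set η := ε / 2 / (t + 1) with hηdef
  have hclose : ∀ a b, |covOf S C p a b - M₀ a b| < ε := by
    intro a b
    have h3 := Matrix.PosSemidef.abs_apply_le (B := η • A) (D := covOf S C p - A)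
      (by convert h1.posSemidef using 1; module) (by convert h2.posSemidef using 1; module) a b
    have hAt : ∀ a, A a a ≤ t := by
      intro a
      have h4 := (abs_lt.1 (hAe a a)).2
      have h5 : M₀ a a + 1 ≤ t := Finset.single_le_sum (f := fun a => M₀ a a + 1)
        (fun a _ => by linarith [hdiag a]) (Finset.mem_univ a)
      linarith [min_le_right (ε / 2) 1]
    have h6 : η * (t + 1) = ε / 2 := by rw [hηdef]; field_simp
    simp only [Matrix.smul_apply, Matrix.sub_apply, smul_eq_mul] at h3
    have h7 : (η * A a a + η * A b b) / 2 ≤ ε / 2 := by nlinarith [hAt a, hAt b]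
    have h8 := (hAe a b).trans_le (min_le_left _ _)
    calc |covOf S C p a b - M₀ a b| = |(covOf S C p a b - A a b) + (A a b - M₀ a b)| := by ring_nf
      _ ≤ |covOf S C p a b - A a b| + |A a b - M₀ a b| := abs_add_le _ _
      _ < ε := by linarith
  obtain ⟨p', hp'K, hp'⟩ := hnear p hclose
  by_contra hrank
  obtain ⟨d, hd, hd0⟩ := exists_pairProducts_mulVec_eq_zero hrank
  have hsame : ∀ q, q ∈ K → covOf S C q = covOf S C p → q = p := by
    intro q hqK hq
    refine huniq q ⟨⟨hqK, ?_⟩, ?_⟩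
    · show (covOf S C q).PosDef
      rw [hq]; exact hpa
    · rw [hq]; exact hpmin
  have hpK' : K ∈ nhds p := hsame p' (interior_subset hp'K) hp' ▸ mem_interior_iff_mem_nhds.1 hp'K
  have hline : ∀ᶠ s in nhds (0 : ℝ), p + s • d ∈ K := by
    have : ContinuousAt (fun s : ℝ => p + s • d) 0 := by fun_prop
    exact this (by simpa using hpK')
  obtain ⟨s, hs, hs0⟩ := ((hline.filter_mono nhdsWithin_le_nhds).and
    (self_mem_nhdsWithin (s := {(0 : ℝ)}ᶜ))).exists
  have := hsame _ hs ((covOf_eq_iff S C _ _).2 (by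
    rw [Matrix.mulVec_add, Matrix.mulVec_smul, hd0, smul_zero, add_zero]))
  rw [add_eq_left, smul_eq_zero] at this
  exact this.elim hs0 hd

lemma hasUniqueMLSolution_iff (K : Set (Fin n → ℝ)) (S : Matrix (Fin m) (Fin n) ℝ)
    (C : Matrix (Fin m) (Fin m) ℝ) (μ : EuclideanSpace ℝ (Fin m)) (L : ℕ)
    (y : ℕ → EuclideanSpace ℝ (Fin m)) :
    HasUniqueMLSolution K S C μ L y ↔ ∃! p, p ∈ K ∧ ∀ q ∈ K,
      gaussLoss (sampleMoment μ L y) (covOf S C p) ≤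
        gaussLoss (sampleMoment μ L y) (covOf S C q) := by
  simp only [HasUniqueMLSolution, mlObjective_eq_gaussLoss]

lemma rank_pairProducts_of_hasUniqueMLSolution {S : Matrix (Fin m) (Fin n) ℝ}
    {C : Matrix (Fin m) (Fin m) ℝ} {μ : EuclideanSpace ℝ (Fin m)} {L : ℕ}
    {y : ℕ → EuclideanSpace ℝ (Fin m)} (h : HasUniqueMLSolution (admissible S C) S C μ L y) :
    (pairProducts S).rank = n := by
  by_contra hrank
  obtain ⟨d, hd, hd0⟩ := exists_pairProducts_mulVec_eq_zero hrank
  obtain ⟨p, ⟨hpa, hpmin⟩, huniq⟩ := (hasUniqueMLSolution_iff _ _ _ _ _ _).1 h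
  have hcov : covOf S C (p + d) = covOf S C p := (covOf_eq_iff S C _ _).2 (by
    rw [Matrix.mulVec_add, hd0, add_zero])
  have := huniq (p + d) ⟨by show (covOf S C (p + d)).PosDef; rw [hcov]; exact hpa, by
    rw [hcov]; exact hpmin⟩
  exact hd (add_eq_left.1 this)

end Deterministic

section Sample

variable {m n : ℕ} {Ω : Type*} [MeasurableSpace Ω] {P : Measure Ω}

lemma received_apply (S : Matrix (Fin m) (Fin n) ℝ) (p : Fin n → ℝ)
    (x : EuclideanSpace ℝ (Fin n)) (w : EuclideanSpace ℝ (Fin m)) (a : Fin m) :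
    received S p x w a = ∑ j, (S a j * √(p j)) * x j + w a := by
  simp [received, Matrix.mulVec, dotProduct, Matrix.mul_diagonal]

lemma measurable_received (S : Matrix (Fin m) (Fin n) ℝ) (p : Fin n → ℝ) (a : Fin m) :
    Measurable fun z : EuclideanSpace ℝ (Fin n) × EuclideanSpace ℝ (Fin m) =>
      received S p z.1 z.2 a := by
  simp only [received_apply]
  fun_prop

lemma memLp_two_eval_of_hasLaw_multivariateGaussian {k : ℕ} {X : Ω → EuclideanSpace ℝ (Fin k)}
    {ν : EuclideanSpace ℝ (Fin k)} {V : Matrix (Fin k) (Fin k) ℝ}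
    (hX : HasLaw X (multivariateGaussian ν V) P) (j : Fin k) : MemLp (fun ω => X ω j) 2 P := by
  have h1 : MemLp id 2 (P.map X) := by
    rw [hX.map_eq]; exact IsGaussian.memLp_two_id
  have h2 : MemLp X 2 P := (memLp_map_measure_iff h1.1 hX.aemeasurable).1 h1
  exact (EuclideanSpace.proj (𝕜 := ℝ) j).comp_memLp' h2

lemma covariance_eval_of_hasLaw_multivariateGaussian {k : ℕ} {X : Ω → EuclideanSpace ℝ (Fin k)}
    {ν : EuclideanSpace ℝ (Fin k)} {V : Matrix (Fin k) (Fin k) ℝ} (hV : V.PosSemidef)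
    (hX : HasLaw X (multivariateGaussian ν V) P) (i j : Fin k) :
    cov[fun ω => X ω i, fun ω => X ω j; P] = V i j := by
  rw [← covariance_eval_multivariateGaussian (μ := ν) hV i j]
  exact hX.covariance_fun_comp (f := fun x => x i) (g := fun x => x j)
    (by fun_prop) (by fun_prop)

lemma integral_eval_of_hasLaw_multivariateGaussian {k : ℕ} {X : Ω → EuclideanSpace ℝ (Fin k)}
    {ν : EuclideanSpace ℝ (Fin k)} {V : Matrix (Fin k) (Fin k) ℝ}
    (hX : HasLaw X (multivariateGaussian ν V) P) (j : Fin k) : ∫ ω, X ω j ∂P = ν j := by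
  have h1 : ∫ ω, X ω j ∂P = ∫ x, EuclideanSpace.proj (𝕜 := ℝ) j x ∂(multivariateGaussian ν V) :=
    hX.integral_comp (f := fun x => EuclideanSpace.proj (𝕜 := ℝ) j x) (by fun_prop)
  rw [h1, ContinuousLinearMap.integral_comp_comm _ IsGaussian.integrable_fun_id,
    integral_id_multivariateGaussian]
  rfl

variable {S : Matrix (Fin m) (Fin n) ℝ}
  {C : Matrix (Fin m) (Fin m) ℝ} {μ : EuclideanSpace ℝ (Fin m)} {p : Fin n → ℝ} {X : Ω → EuclideanSpace ℝ (Fin n)}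
  {N : Ω → EuclideanSpace ℝ (Fin m)}

lemma memLp_two_received (hX : HasLaw X (multivariateGaussian 0 (1 : Matrix (Fin n) (Fin n) ℝ)) P)
    (hN : HasLaw N (multivariateGaussian μ C) P) (a : Fin m) :
    MemLp (fun ω => received S p (X ω) (N ω) a) 2 P := by
  simp only [received_apply]
  exact (memLp_finsetSum _ fun j _ =>
    (memLp_two_eval_of_hasLaw_multivariateGaussian hX j).const_mul _).add
      (memLp_two_eval_of_hasLaw_multivariateGaussian hN a)

variable [IsProbabilityMeasure P]

lemma integral_received (hX : HasLaw X (multivariateGaussian 0 (1 : Matrix (Fin n) (Fin n) ℝ)) P)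
    (hN : HasLaw N (multivariateGaussian μ C) P) (a : Fin m) :
    ∫ ω, received S p (X ω) (N ω) a ∂P = μ a := by
  have hXi : ∀ j, Integrable (fun ω => (S a j * √(p j)) * X ω j) P := fun j =>
    ((memLp_two_eval_of_hasLaw_multivariateGaussian hX j).integrable (by norm_num)).const_mul _
  simp only [received_apply]
  rw [integral_add (integrable_finsetSum _ fun j _ => hXi j)
    ((memLp_two_eval_of_hasLaw_multivariateGaussian hN a).integrable (by norm_num)),
    integral_finsetSum _ fun j _ => hXi j, integral_eval_of_hasLaw_multivariateGaussian hN]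
  simp [integral_const_mul, integral_eval_of_hasLaw_multivariateGaussian hX]

/-- The covariance matrix of the received vector. -/
lemma covariance_received (hC : C.PosSemidef) (hp : ∀ j, 0 ≤ p j)
    (hX : HasLaw X (multivariateGaussian 0 (1 : Matrix (Fin n) (Fin n) ℝ)) P)
    (hN : HasLaw N (multivariateGaussian μ C) P) (hXN : IndepFun X N P) (a b : Fin m) :
    cov[fun ω => received S p (X ω) (N ω) a, fun ω => received S p (X ω) (N ω) b; P] =
      covOf S C p a b := by
  have hXm := memLp_two_eval_of_hasLaw_multivariateGaussian hX
  have hNm := memLp_two_eval_of_hasLaw_multivariateGaussian hN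
  set U : Fin m → Ω → ℝ := fun a ω => ∑ j, (S a j * √(p j)) * X ω j with hU
  have hUm : ∀ a, MemLp (U a) 2 P := fun a =>
    memLp_finsetSum _ fun j _ => (hXm j).const_mul _
  have hrec : ∀ a, (fun ω => received S p (X ω) (N ω) a) = U a + fun ω => N ω a := by
    intro a; ext ω; rw [received_apply]; rfl
  have hindep : ∀ a b, IndepFun (U a) (fun ω => N ω b) P := fun a b =>
    IndepFun.comp (φ := fun x : EuclideanSpace ℝ (Fin n) => ∑ j, (S a j * √(p j)) * x j)
      (ψ := fun w : EuclideanSpace ℝ (Fin m) => w b) hXN (by fun_prop) (by fun_prop)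
  have hUU : cov[U a, U b; P] = (S * Matrix.diagonal p * Sᵀ) a b := by
    rw [hU, covariance_fun_sum_fun_sum (fun j => (hXm j).const_mul _)
      (fun j => (hXm j).const_mul _)]
    simp only [covariance_const_mul_left, covariance_const_mul_right,
      covariance_eval_of_hasLaw_multivariateGaussian Matrix.PosSemidef.one hX, Matrix.one_apply,
      mul_ite, mul_one, mul_zero, Finset.sum_ite_eq, Finset.mem_univ, if_true]
    simp only [Matrix.mul_apply (N := Sᵀ), Matrix.mul_diagonal, Matrix.transpose_apply]
    refine Finset.sum_congr rfl fun j _ => ?_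
    calc S b j * √(p j) * (S a j * √(p j)) = S a j * (√(p j) * √(p j)) * S b j := by ring
      _ = _ := by rw [Real.mul_self_sqrt (hp j)]
  rw [hrec a, hrec b, covariance_add_left (hUm a) (hNm a) ((hUm b).add (hNm b)),
    covariance_add_right (hUm a) (hUm b) (hNm b), covariance_add_right (hNm a) (hUm b) (hNm b),
    hUU, (hindep a b).covariance_eq_zero (hUm a) (hNm b), covariance_comm,
    (hindep b a).covariance_eq_zero (hUm b) (hNm a),
    covariance_eval_of_hasLaw_multivariateGaussian hC hN, covOf, Matrix.add_apply, add_zero,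
    zero_add]

end Sample

/-- Strong law of large numbers for the sample second moment matrix. -/
lemma ae_tendsto_sampleMoment {m n : ℕ} {Ω : Type*} [MeasurableSpace Ω] {P : Measure Ω}
    [IsProbabilityMeasure P] {S : Matrix (Fin m) (Fin n) ℝ} {C : Matrix (Fin m) (Fin m) ℝ}
    (hC : C.PosSemidef) {μ : EuclideanSpace ℝ (Fin m)} {p : Fin n → ℝ}
    {X : ℕ → Ω → EuclideanSpace ℝ (Fin n)} {N : ℕ → Ω → EuclideanSpace ℝ (Fin m)}
    (hp : ∀ j, 0 ≤ p j)
    (hX : ∀ i, HasLaw (X i) (multivariateGaussian 0 (1 : Matrix (Fin n) (Fin n) ℝ)) P)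
    (hN : ∀ i, HasLaw (N i) (multivariateGaussian μ C) P)
    (hXN : ∀ i, IndepFun (X i) (N i) P) (hind : iIndepFun (fun i ω => (X i ω, N i ω)) P) :
    ∀ᵐ ω ∂P, Tendsto (fun L => sampleMoment μ L (fun i => received S p (X i ω) (N i ω))) atTop
      (nhds (covOf S C p)) := by
  have hentry : ∀ a b, ∀ᵐ ω ∂P, Tendsto
      (fun L => sampleMoment μ L (fun i => received S p (X i ω) (N i ω)) a b) atTop
      (nhds (covOf S C p a b)) := by
    intro a b
    set φ : EuclideanSpace ℝ (Fin n) × EuclideanSpace ℝ (Fin m) → ℝ :=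
      fun z => (received S p z.1 z.2 a - μ a) * (received S p z.1 z.2 b - μ b) with hφ
    have hφm : Measurable φ := ((measurable_received S p a).sub_const _).mul
      ((measurable_received S p b).sub_const _)
    have hpair : ∀ i, IdentDistrib (fun ω => (X i ω, N i ω)) (fun ω => (X 0 ω, N 0 ω)) P P := by
      intro i
      have h (i) := (indepFun_iff_map_prod_eq_prod_map_map (hX i).aemeasurable
        (hN i).aemeasurable).1 (hXN i)
      refine ⟨(hX i).aemeasurable.prodMk (hN i).aemeasurable,
        (hX 0).aemeasurable.prodMk (hN 0).aemeasurable, ?_⟩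
      rw [h, h, (hX i).map_eq, (hX 0).map_eq, (hN i).map_eq, (hN 0).map_eq]
    have hint : Integrable (fun ω => φ (X 0 ω, N 0 ω)) P :=
      ((memLp_two_received (hX 0) (hN 0) a).sub (memLp_const _)).integrable_mul
        ((memLp_two_received (hX 0) (hN 0) b).sub (memLp_const _))
    have hmean : ∫ ω, φ (X 0 ω, N 0 ω) ∂P = covOf S C p a b := by
      rw [← covariance_received (S := S) hC hp (hX 0) (hN 0) (hXN 0) a b, covariance,
        integral_received (hX 0) (hN 0), integral_received (hX 0) (hN 0)]
    have hlaw := strong_law_ae_real (fun i ω => φ (X i ω, N i ω)) hint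
      (fun i j hij => (hind.indepFun hij).comp hφm hφm) (fun i => (hpair i).comp hφm)
    filter_upwards [hlaw] with ω hω
    rw [hmean] at hω
    refine hω.congr fun L => ?_
    simp only [sampleMoment, Matrix.smul_apply, Matrix.sum_apply, Matrix.vecMulVec_apply,
      smul_eq_mul, hφ]
    rw [div_eq_inv_mul, one_div]
    rfl
  have hall : ∀ᵐ ω ∂P, ∀ a b, Tendsto
      (fun L => sampleMoment μ L (fun i => received S p (X i ω) (N i ω)) a b) atTop
      (nhds (covOf S C p a b)) := ae_all_iff.2 fun a => ae_all_iff.2 fun b => hentry a b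
  filter_upwards [hall] with ω hω
  exact tendsto_pi_nhds.2 fun a => tendsto_pi_nhds.2 fun b => hω a b

theorem theorem1 {m n : ℕ} (S : Matrix (Fin m) (Fin n) ℝ) (C : Matrix (Fin m) (Fin m) ℝ)
    (hC : C.PosSemidef) (μ : EuclideanSpace ℝ (Fin m)) :
    -- necessity: for every sample size and every observed sample
    (∀ (L : ℕ) (y : ℕ → EuclideanSpace ℝ (Fin m)),
      HasUniqueMLSolution (admissible S C) S C μ L y → (pairProducts S).rank = n) ∧
    -- the channel model with true powers `p`
    (∀ {Ω : Type*} [MeasurableSpace Ω] (P : Measure Ω) [IsProbabilityMeasure P]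
      (p : Fin n → ℝ) (X : ℕ → Ω → EuclideanSpace ℝ (Fin n))
      (N : ℕ → Ω → EuclideanSpace ℝ (Fin m)),
      (∀ j, 0 ≤ p j) → (covOf S C p).PosDef →
      (∀ i, HasLaw (X i) (multivariateGaussian 0 (1 : Matrix (Fin n) (Fin n) ℝ)) P) →
      (∀ i, HasLaw (N i) (multivariateGaussian μ C) P) →
      (∀ i, IndepFun (X i) (N i) P) →
      iIndepFun (fun i ω => (X i ω, N i ω)) P →
      -- sufficiency, almost surely for all sufficiently large sample sizes
      ((pairProducts S).rank = n →
        ∀ᵐ ω ∂P, ∀ᶠ L in atTop,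
          HasUniqueMLSolution (admissible S C) S C μ L
            (fun i => received S p (X i ω) (N i ω)) ∧
          HasUniqueMLSolution (admissibleNonneg S C) S C μ L
            (fun i => received S p (X i ω) (N i ω))) ∧
      -- necessity for the minimization restricted to nonnegative powers
      ((∀ j, 0 < p j) →
        ∀ᵐ ω ∂P, ∀ᶠ L in atTop,
          HasUniqueMLSolution (admissibleNonneg S C) S C μ L
            (fun i => received S p (X i ω) (N i ω)) →
          (pairProducts S).rank = n)) := by
  refine ⟨fun L y h => rank_pairProducts_of_hasUniqueMLSolution h, ?_⟩
  intro Ω _ P _ p X N hp hM hX hN hXN hind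
  have hlim := ae_tendsto_sampleMoment (S := S) hC hp hX hN hXN hind
  set K : Set (Fin n → ℝ) := {q | ∀ j, 0 ≤ q j} with hK
  have hKadm : admissibleNonneg S C = K ∩ admissible S C := rfl
  refine ⟨fun hrank => ?_, fun hpos => ?_⟩
  · have hinj := pairProducts_mulVec_injective_of_rank hrank
    have hKclosed : IsClosed K := isClosed_Ici (a := (0 : Fin n → ℝ))
    have hKconvex : Convex ℝ K := convex_Ici (0 : Fin n → ℝ)
    have h1 := eventually_existsUnique_minimizer (C := C) hinj isClosed_univ convex_univ
      (Set.mem_univ p) hM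
    have h2 := eventually_existsUnique_minimizer (C := C) hinj hKclosed hKconvex hp hM
    filter_upwards [hlim] with ω hω
    filter_upwards [hω.eventually h1, hω.eventually h2] with L hL1 hL2
    rw [Set.univ_inter] at hL1
    rw [hasUniqueMLSolution_iff, hasUniqueMLSolution_iff, hKadm]
    exact ⟨hL1 (sampleMoment_posSemidef _ _ _), hL2 (sampleMoment_posSemidef _ _ _)⟩
  · have hKnhds : K ∈ nhds p :=
      mem_of_superset (set_pi_mem_nhds Set.finite_univ fun j _ => Ici_mem_nhds (hpos j))
        fun q hq j => hq j (Set.mem_univ j)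
    have h1 := eventually_rank_of_existsUnique_minimizer hKnhds hM
    filter_upwards [hlim] with ω hω
    filter_upwards [hω.eventually h1] with L hL
    rw [hasUniqueMLSolution_iff, hKadm]
    exact hL (sampleMoment_posSemidef _ _ _)
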